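/- Let $n$ be a positive integer, $\mathbf k$ a field (of any characteristic), $U$ a three-dimensional vector space over $\mathbf k$ with basis $x,y,z$ and dual basis $x^*,y^*,z^*$ of $U^*$, $P=\operatorname{Sym}_\bullet(U)=\mathbf k[x,y,z]$, and let $D_\bullet(U^*)$ be the divided power algebra of $U^*$, with divided powers $w\mapsto w^{(a)}$. Regard $D_\bullet(U^*)$ as a $P$-module by letting each $u\in U$ act as the derivation with $u(w^{(a)})=w(u)\,w^{(a-1)}$ for $w\in U^*$, $a\ge 1$. Let $H_n$ be the $(2n+1)\times(2n+1)$ alternating matrix over $P$ whose only non-zero entries above the main diagonal are $$(H_n)_{i,j}=\begin{cases}x&\text{if } i \text{ is odd and } j=i+1,\\ y&\text{if } i \text{ is even and } j=i+1,\\ z&\text{if } j=2n+2-i,\end{cases}$$ and let the Buchsbaum–Eisenbud ideal $\mathrm{BE}_n$ be the ideal of $P$ generated by the maximal order Pfaffians of $H_n$, that is, by the Pfaffians of the $2n\times 2n$ matrices obtained from $H_n$ by deleting row and column $i$, for $1\le i\le 2n+1$. Then $\mathrm{BE}_n$ is a grade three Gorenstein ideal (it is homogeneous, and $P/\mathrm{BE}_n$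 is Artinian with a one-dimensional socle), and its Macaulay inverse system $$\operatorname{ann}(\mathrm{BE}_n)=\{w\in D_\bullet(U^*)\mid rw=0 \text{ for all } r\in \mathrm{BE}_n\}$$ is the $P$-submodule of $D_\bullet(U^*)$ generated by $$\varphi_n=\sum_{i=0}^{n-1}(-1)^i c_i\,{x^*}^{(n-1-i)}{y^*}^{(n-1-i)}{z^*}^{(2i)}\in D_{2n-2}(U^*),$$ where $c_i=\frac1{i+1}\binom{2i}{i}$ is the $i$-th Catalan number. -/

import Mathlib

noncomputable section

namespace MacaulayInverse

/-! ### Pfaffians and the Buchsbaum-Eisenbud matrices -/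

/-- The Pfaffian of an alternating matrix, by expansion along the first row:
`Pf Z = ∑ j ≥ 2, (-1) ^ j * z 1 j * Pf (Z without rows and columns 1 and j)`
(with rows and columns numbered from `1`). It is `1` in size `0` and `0` in odd sizes. -/
def pfaffian {R : Type*} [CommRing R] : (m : ℕ) → Matrix (Fin m) (Fin m) R → R
  | 0, _ => 1
  | 1, _ => 0
  | m + 2, Z => ∑ j : Fin (m + 1), (-1) ^ (j : ℕ) * Z 0 j.succ *
      pfaffian m (Z.submatrix (fun t => (j.succAbove t).succ) (fun t => (j.succAbove t).succ))

/-- The entries above the main diagonal of the Buchsbaum-Eisenbud matrix. The indices start at `0`,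
so the row numbered `i + 1` from `1` is odd exactly when `i` is even. -/
def buchsbaumEisenbudUpper {R : Type*} [CommRing R] (x y z : R) (n i j : ℕ) : R :=
  if j = i + 1 then (if Even i then x else y) else if i + j = 2 * n then z else 0

/-- The `(2n+1) × (2n+1)` alternating matrix `H_n(x, y, z)`. -/
def buchsbaumEisenbudMatrix {R : Type*} [CommRing R] (x y z : R) (n : ℕ) :
    Matrix (Fin (2 * n + 1)) (Fin (2 * n + 1)) R :=
  Matrix.of fun i j =>
    if i < j then buchsbaumEisenbudUpper x y z n i j
    else if j < i then -buchsbaumEisenbudUpper x y z n j i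
    else 0

/-- The ideal generated by the maximal order Pfaffians of `H_n(x, y, z)`: for each `i`, the Pfaffian
of the `2n × 2n` matrix obtained by deleting row and column `i`. -/
def buchsbaumEisenbudIdeal {R : Type*} [CommRing R] (x y z : R) (n : ℕ) : Ideal R :=
  Ideal.span (Set.range fun i : Fin (2 * n + 1) =>
    pfaffian (2 * n) ((buchsbaumEisenbudMatrix x y z n).submatrix i.succAbove i.succAbove))

/-! ### The action of the symmetric algebra on the divided power algebra -/

section Action

variable (k : Type*) [Field k] (U : Type*) [AddCommGroup U] [Module k U]

/-- The divided power algebra `D(U*)` of the dual space of `U`. -/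
abbrev DualDP : Type _ := DividedPowerAlgebra k (Module.Dual k U)

variable {k U}

/-- The value `v(w) • w^{(a-1)}` of the derivation given by `v` at `w^{(a)}` (and `0` if `a = 0`). -/
def contractGen (v : U) : ℕ → Module.Dual k U → DualDP k U
  | 0, _ => 0
  | a + 1, w => w v • DividedPowerAlgebra.dp k a w

theorem contractGen_smul (v : U) (a : ℕ) (r : k) (w : Module.Dual k U) :
    contractGen v a (r • w) = r ^ a • contractGen v a w := by
  cases a with
  | zero => simp [contractGen]
  | succ a =>
    simp only [contractGen, LinearMap.smul_apply, smul_eq_mul, DividedPowerAlgebra.dp_smul,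
      smul_smul]
    congr 1
    ring

theorem contractGen_mul (v : U) (a c : ℕ) (w : Module.Dual k U) :
    DividedPowerAlgebra.dp k a w * contractGen v c w +
      contractGen v a w * DividedPowerAlgebra.dp k c w =
    (a + c).choose a • contractGen v (a + c) w := by
  rcases a with _ | a
  · simp [contractGen, DividedPowerAlgebra.dp_zero]
  rcases c with _ | c
  · simp [contractGen, DividedPowerAlgebra.dp_zero]
  have h : a + 1 + (c + 1) = (a + c + 1) + 1 := by ring
  rw [h]
  simp only [contractGen]
  rw [mul_smul_comm, smul_mul_assoc, DividedPowerAlgebra.dp_mul, DividedPowerAlgebra.dp_mul,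
    show a + 1 + c = a + c + 1 by ring, show a + (c + 1) = a + c + 1 by ring, ← smul_add,
    ← add_smul, smul_comm, Nat.choose_succ_succ (a + c + 1) a, add_comm ((a + c + 1).choose a)]

theorem contractGen_add (v : U) (a : ℕ) (w w' : Module.Dual k U) :
    contractGen v a (w + w') = ∑ p ∈ Finset.HasAntidiagonal.antidiagonal a,
      (DividedPowerAlgebra.dp k p.1 w * contractGen v p.2 w' +
        contractGen v p.1 w * DividedPowerAlgebra.dp k p.2 w') := by
  cases a with
  | zero => simp [contractGen]
  | succ a =>
    rw [Finset.sum_add_distrib,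
      Finset.Nat.sum_antidiagonal_succ' (f := fun p =>
        DividedPowerAlgebra.dp k p.1 w * contractGen v p.2 w'),
      Finset.Nat.sum_antidiagonal_succ (f := fun p =>
        contractGen v p.1 w * DividedPowerAlgebra.dp k p.2 w')]
    simp [contractGen, DividedPowerAlgebra.dp_add, Finset.smul_sum, add_smul, Finset.sum_add_distrib,
      add_comm]

/-- The algebra homomorphism `w^{(a)} ↦ w^{(a)} + ε v(w) w^{(a-1)}` to the dual numbers. -/
def contractDual (v : U) : DualDP k U →ₐ[k] DualNumber (DualDP k U) :=
  DividedPowerAlgebra.lift' (R := k) (M := Module.Dual k U) (A := DualNumber (DualDP k U))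
    (f := fun p => (TrivSqZeroExt.inl (DividedPowerAlgebra.dp k p.1 p.2) +
      TrivSqZeroExt.inr (contractGen v p.1 p.2) : DualNumber (DualDP k U)))
    (fun m => by
      ext <;> simp [contractGen, DividedPowerAlgebra.dp_zero])
    (fun n r m => by
      ext <;> simp [contractGen_smul, DividedPowerAlgebra.dp_smul])
    (fun n p m => by
      ext
      · simp [DividedPowerAlgebra.dp_mul]
      · have h := contractGen_mul v n p m
        simp only [TrivSqZeroExt.snd_mul, TrivSqZeroExt.fst_add, TrivSqZeroExt.snd_add,
          TrivSqZeroExt.fst_inl, TrivSqZeroExt.snd_inl, TrivSqZeroExt.fst_inr,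
          TrivSqZeroExt.snd_inr, TrivSqZeroExt.snd_smul, zero_add, add_zero, smul_eq_mul,
          MulOpposite.smul_eq_mul_unop, MulOpposite.unop_op]
        exact h)
    (fun n u v => by
      ext
      · rw [← TrivSqZeroExt.fstHom_apply k, ← TrivSqZeroExt.fstHom_apply k, map_sum]
        simp [DividedPowerAlgebra.dp_add]
      · rw [← TrivSqZeroExt.sndHom_apply (R := DualDP k U), ← TrivSqZeroExt.sndHom_apply (R := DualDP k U), map_sum]
        simp [contractGen_add])

theorem fst_contractDual (v : U) (a : DualDP k U) :
    TrivSqZeroExt.fst (contractDual v a) = a := by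
  have h : (TrivSqZeroExt.fstHom k (DualDP k U) (DualDP k U)).comp (contractDual v) =
      AlgHom.id k _ :=
    DividedPowerAlgebra.algHom_ext fun n m => by simp [contractDual]
  exact congr($h a)

/-- The divided power derivation of `D(U*)` given by `v`. -/
def contract (v : U) : Derivation k (DualDP k U) (DualDP k U) :=
  Derivation.mk'
    { toFun := fun a => TrivSqZeroExt.snd (contractDual v a)
      map_add' := fun a c => by simp
      map_smul' := fun r a => by simp }
    (fun a c => by simp [fst_contractDual, mul_comm])

@[simp]
theorem contract_dp_zero (v : U) (w : Module.Dual k U) :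
    contract v (DividedPowerAlgebra.dp k 0 w) = 0 := by
  simp [DividedPowerAlgebra.dp_zero]

@[simp]
theorem contract_dp_succ (v : U) (a : ℕ) (w : Module.Dual k U) :
    contract v (DividedPowerAlgebra.dp k (a + 1) w) =
      w v • DividedPowerAlgebra.dp k a w := by
  simp [contract, contractDual, contractGen]

theorem contract_ext {d d' : Derivation k (DualDP k U) (DualDP k U)}
    (h : ∀ n w, d (DividedPowerAlgebra.dp k n w) = d' (DividedPowerAlgebra.dp k n w)) :
    d = d' := by
  ext a
  induction a using DividedPowerAlgebra.induction_on with
  | C r => simp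
  | add f g hf hg => simp [hf, hg]
  | dp f n w hf => simp [hf, h]

theorem contract_comm (u v : U) (a : DualDP k U) :
    contract u (contract v a) = contract v (contract u a) := by
  have h : ⁅(contract u : Derivation k (DualDP k U) (DualDP k U)),
      (contract v : Derivation k (DualDP k U) (DualDP k U))⁆ = 0 := by
    refine contract_ext fun n w => ?_
    rcases n with _ | _ | n <;>
      simp [Derivation.commutator_apply, DividedPowerAlgebra.dp_zero, smul_smul, mul_comm]
  have := congr($h a)
  rw [Derivation.commutator_apply] at this
  exact sub_eq_zero.mp this

variable (k U) in
/-- The linear map sending `v` to the derivation it gives, as an endomorphism of `D(U*)`. -/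
def contractLinear : U →ₗ[k] Module.End k (DualDP k U) where
  toFun v := (contract v).toLinearMap
  map_add' u v := by
    have h : (contract (u + v) : Derivation k (DualDP k U) (DualDP k U)) =
        contract u + contract v :=
      contract_ext fun n w => by rcases n with _ | n <;> simp [add_smul]
    ext a
    exact congr($h a)
  map_smul' r v := by
    have h : (contract (r • v) : Derivation k (DualDP k U) (DualDP k U)) = r • contract v :=
      contract_ext fun n w => by rcases n with _ | n <;> simp [smul_smul]
    ext a
    exact congr($h a)

variable (k U) in
/-- The action of `Sym(U)` on `D(U*)`: the algebra homomorphism that extends `v ↦ contract v`. -/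
def contractAlgHom : SymmetricAlgebra k U →ₐ[k] Module.End k (DualDP k U) :=
  RingCon.liftₐ (TensorAlgebra.symRingCon k U) (TensorAlgebra.lift k (contractLinear k U)) <| by
    refine RingCon.ringConGen_le.2 fun a c h => ?_
    induction h with
    | mul_comm x y =>
      rw [RingCon.ker_apply]
      ext a
      simpa [contractLinear] using contract_comm x y a

@[simp]
theorem contractAlgHom_ι (v : U) (a : DualDP k U) :
    contractAlgHom k U (SymmetricAlgebra.ι k U v) a = contract v a := by
  simp [contractAlgHom, SymmetricAlgebra.ι, SymmetricAlgebra.algHom, contractLinear]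

/-- `D(U*)` as a module over `Sym(U)`. -/
instance instModuleDualDP : Module (SymmetricAlgebra k U) (DualDP k U) :=
  Module.compHom (DualDP k U) (contractAlgHom k U).toRingHom

theorem smul_def (r : SymmetricAlgebra k U) (a : DualDP k U) :
    r • a = contractAlgHom k U r a := rfl

theorem ι_smul (v : U) (a : DualDP k U) : SymmetricAlgebra.ι k U v • a = contract v a := by
  rw [smul_def, contractAlgHom_ι]

/-! ### Inverse systems and Gorenstein ideals -/

/-- `ann I = {w ∈ D(U*) | r w = 0 for all r ∈ I}`. -/
def inverseSystem (I : Ideal (SymmetricAlgebra k U)) :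
    Submodule (SymmetricAlgebra k U) (DualDP k U) :=
  Submodule.torsionBySet (SymmetricAlgebra k U) (DualDP k U) I

variable (k U) in
/-- The homogeneous component `Sym_r(U)`: the span of the `r`-fold products of elements of `U`. -/
def symDegree (r : ℕ) : Submodule k (SymmetricAlgebra k U) :=
  LinearMap.range (SymmetricAlgebra.ι k U) ^ r

variable (k U) in
/-- The homogeneous component `D_r(U*)`: the span of the products
`w₁^{(a₁)} ⋯ w_s^{(a_s)}` with `a₁ + ⋯ + a_s = r`. -/
def dpDegree (r : ℕ) : Submodule k (DualDP k U) :=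
  Submodule.span k {a | ∃ l : List (ℕ × Module.Dual k U), (l.map Prod.fst).sum = r ∧
    a = (l.map fun p => DividedPowerAlgebra.dp k p.1 p.2).prod}

/-- A homogeneous ideal: one that is generated by homogeneous elements. -/
def IsHomogeneousIdeal (I : Ideal (SymmetricAlgebra k U)) : Prop :=
  Ideal.span {r | r ∈ I ∧ ∃ d, r ∈ symDegree k U d} = I

/-- The socle of `Sym(U)/I`, that is, the elements that are killed by all elements of positive
degree; it is enough to take those of degree one. -/
def socle (I : Ideal (SymmetricAlgebra k U)) : Submodule k (SymmetricAlgebra k U ⧸ I) where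
  carrier := {a | ∀ u : U, Ideal.Quotient.mk I (SymmetricAlgebra.ι k U u) * a = 0}
  add_mem' ha hc u := by rw [mul_add, ha u, hc u, add_zero]
  zero_mem' u := mul_zero _
  smul_mem' r a ha u := by rw [mul_smul_comm, ha u, smul_zero]

/-- A homogeneous ideal `I` of `Sym(U)` is Gorenstein of grade `dim U` if `Sym(U)/I` is Artinian
with a one-dimensional socle. -/
structure IsGorensteinIdeal (I : Ideal (SymmetricAlgebra k U)) : Prop where
  homogeneous : IsHomogeneousIdeal I
  artinian : IsArtinianRing (SymmetricAlgebra k U ⧸ I)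
  finrank_socle : Module.finrank k (socle I) = 1

/-! ### The Buchsbaum-Eisenbud ideal of `Sym(U)` and the element `φ_n` -/

/-- The ideal `BE_n` of `Sym(U) = k[x, y, z]`, where `x, y, z` is the basis `b` of `U`. -/
def BE (b : Module.Basis (Fin 3) k U) (n : ℕ) : Ideal (SymmetricAlgebra k U) :=
  buchsbaumEisenbudIdeal (SymmetricAlgebra.ι k U (b 0)) (SymmetricAlgebra.ι k U (b 1))
    (SymmetricAlgebra.ι k U (b 2)) n

/-- `φ_n = ∑_{i < n} (-1)^i c_i x*^{(n-1-i)} y*^{(n-1-i)} z*^{(2i)}`, where `x*, y*, z*` is the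
basis dual to `b` and `c_i` is the `i`-th Catalan number. -/
def phi (b : Module.Basis (Fin 3) k U) (n : ℕ) : DualDP k U :=
  ∑ i ∈ Finset.range n, ((-1) ^ i * (catalan i : k)) •
    (DividedPowerAlgebra.dp k (n - 1 - i) (b.coord 0) *
      DividedPowerAlgebra.dp k (n - 1 - i) (b.coord 1) *
      DividedPowerAlgebra.dp k (2 * i) (b.coord 2))


end Action

end MacaulayInverse

end

/-! Put `F_0 = 1`, `F_1 = z`, `F_{i+2} = z F_{i+1} + x y F_i`. Expanding the Pfaffians of `H_n`
along the first row shows that, up to order, the generators of `BE_n` are `x^m F_i` and `y^m F_i`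
with `i + m = n`. Hence `BE_n` contains every `x^a y^c F_i` with `max(a, c) + i ≥ n`; call the
finitely many other exponents standard. As `F_i` is monic of degree `i` in `z`, the elements `x^a
y^c F_i` span `Sym(U)`.

The signed Catalan numbers in `φ_n` are moments for which the `F_i`, Chebyshev polynomials in
disguise, are orthogonal: the pairing of `φ_n` with `x^a y^c F_i F_j` is `(-1)^i` if `i = j` and `a
= c = n - 1 - i`, and `0` otherwise (`pairing_phi_continuantBasis_mul`). So `φ_n` is orthogonal to
all multiples of the non-standard elements, while each standard `(a, c, i)` has, up to sign, the
dual element `(n-1-i-a, n-1-i-c, i)`. The values are units in every characteristic.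

Expansion in this dual system gives everything. Modulo `BE_n` the coefficients of `r` depend only on
`r φ_n`, so `BE_n` is the annihilator of `φ_n` and the quotient is finite-dimensional. An element of
`D(U*)` killed by `BE_n` is determined by its pairings with the standard elements, and a multiple of
`φ_n` realises them. A socle element sends `φ_n` to a constant, so the socle is the line through
`x^(n-1) y^(n-1)`. -/

noncomputable section

namespace MacaulayInverse

/-! ### Pfaffian expansions -/

section Pfaffians

variable {R : Type*} [CommRing R]

/-- The Pfaffian of the leading `m × m` block of an infinite matrix. -/
def leadingPfaffian (m : ℕ) (A : ℕ → ℕ → R) : R :=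
  pfaffian m (Matrix.of fun i j : Fin m => A i j)

/-- The increasing enumeration of the positive integers different from `j + 1`. -/
def skipIndex (j a : ℕ) : ℕ := (if a < j then a else a + 1) + 1

theorem val_succAbove {m : ℕ} (i : Fin (m + 1)) (a : Fin m) :
    (i.succAbove a : ℕ) = if (a : ℕ) < i then (a : ℕ) else a + 1 := by
  by_cases h : (a : ℕ) < i
  · rw [Fin.succAbove_of_castSucc_lt _ _ (by simpa [Fin.lt_def] using h), if_pos h]
    simp
  · rw [Fin.succAbove_of_le_castSucc _ _ (by simpa [Fin.le_def] using h), if_neg h]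
    simp

theorem leadingPfaffian_zero (A : ℕ → ℕ → R) : leadingPfaffian 0 A = 1 := by
  simp [leadingPfaffian, pfaffian]

theorem leadingPfaffian_one (A : ℕ → ℕ → R) : leadingPfaffian 1 A = 0 := by
  simp [leadingPfaffian, pfaffian]

theorem leadingPfaffian_add_two (m : ℕ) (A : ℕ → ℕ → R) :
    leadingPfaffian (m + 2) A = ∑ j ∈ Finset.range (m + 1), (-1) ^ j * A 0 (j + 1) *
      leadingPfaffian m (fun a c => A (skipIndex j a) (skipIndex j c)) := by
  rw [leadingPfaffian, pfaffian, ← Fin.sum_univ_eq_sum_range (fun j => (-1) ^ j * A 0 (j + 1) *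
      leadingPfaffian m (fun a c => A (skipIndex j a) (skipIndex j c)))]
  refine Finset.sum_congr rfl fun j _ => ?_
  congr 1
  rw [leadingPfaffian]
  congr 1
  ext a c
  simp [skipIndex, val_succAbove]

/-- The Pfaffian only depends on the entries above the main diagonal. -/
theorem leadingPfaffian_congr {m : ℕ} {A B : ℕ → ℕ → R}
    (h : ∀ a c, a < c → c < m → A a c = B a c) : leadingPfaffian m A = leadingPfaffian m B := by
  induction m using Nat.twoStepInduction generalizing A B with
  | zero => simp [leadingPfaffian_zero]
  | one => simp [leadingPfaffian_one]
  | more m ih _ =>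
    rw [leadingPfaffian_add_two, leadingPfaffian_add_two]
    refine Finset.sum_congr rfl fun j hj => ?_
    rw [Finset.mem_range] at hj
    rw [h 0 (j + 1) (by omega) (by omega)]
    congr 1
    refine ih fun a c hac hc => h _ _ ?_ ?_ <;> unfold skipIndex <;> split_ifs <;> omega

/-- If the last column has a single non-zero entry, in the last but one row, then the Pfaffian
factors. -/
theorem leadingPfaffian_of_last_column {m : ℕ} {A : ℕ → ℕ → R} (h : ∀ a < m, A a (m + 1) = 0) :
    leadingPfaffian (m + 2) A = A m (m + 1) * leadingPfaffian m A := by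
  induction m using Nat.twoStepInduction generalizing A with
  | zero => simp [leadingPfaffian_add_two, leadingPfaffian_zero]
  | one => simp [leadingPfaffian_add_two, leadingPfaffian_one]
  | more m ih _ =>
    rw [leadingPfaffian_add_two, Finset.sum_range_succ, Finset.sum_range_succ, h 0 (by omega)]
    have key : ∀ j ≤ m + 1,
        leadingPfaffian (m + 2) (fun a c => A (skipIndex j a) (skipIndex j c)) =
          A (skipIndex j m) (m + 3) *
            leadingPfaffian m (fun a c => A (skipIndex j a) (skipIndex j c)) := by
      intro j hj
      have hl : skipIndex j (m + 1) = m + 3 := by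
        unfold skipIndex; split_ifs <;> omega
      rw [ih, hl]
      intro a ha
      rw [hl]
      apply h
      unfold skipIndex; split_ifs <;> omega
    have hm : skipIndex (m + 1) m = m + 1 := by simp [skipIndex]
    -- The minor for `j = m + 1` omits row `m + 2`, the only one that meets the last column, so it
    -- vanishes.
    rw [key (m + 1) le_rfl, hm, h (m + 1) (by omega), leadingPfaffian_add_two m A, Finset.mul_sum]
    simp only [mul_zero, zero_mul, add_zero]
    refine Finset.sum_congr rfl fun j hj => ?_
    rw [Finset.mem_range] at hj
    have hm : skipIndex j m = m + 2 := by
      unfold skipIndex; split_ifs <;> omega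
    rw [key j (by omega), hm]
    ring

/-- Expansion along a first row with at most one non-zero entry, in the second column. -/
theorem leadingPfaffian_of_first_row_single {m : ℕ} {A : ℕ → ℕ → R}
    (h : ∀ c, 1 < c → c < m + 2 → A 0 c = 0) :
    leadingPfaffian (m + 2) A = A 0 1 * leadingPfaffian m (fun a c => A (a + 2) (c + 2)) := by
  rw [leadingPfaffian_add_two, Finset.sum_range_succ', Finset.sum_eq_zero, zero_add]
  · simp [skipIndex]
  · intro j hj
    rw [Finset.mem_range] at hj
    rw [h _ (by omega) (by omega)]
    simp

/-- Expansion along a first row with at most two non-zero entries, in the second and in the last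
column. -/
theorem leadingPfaffian_of_first_row {m : ℕ} {A : ℕ → ℕ → R}
    (h : ∀ c, 1 < c → c < m + 2 → A 0 c = 0) :
    leadingPfaffian (m + 3) A =
      A 0 1 * leadingPfaffian (m + 1) (fun a c => A (a + 2) (c + 2)) +
      (-1) ^ (m + 1) * A 0 (m + 2) * leadingPfaffian (m + 1) (fun a c => A (a + 1) (c + 1)) := by
  rw [leadingPfaffian_add_two, Finset.sum_range_succ, Finset.sum_range_succ',
    Finset.sum_eq_zero (s := Finset.range m), zero_add]
  · congr 1
    · simp [skipIndex]
    · congr 1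
      refine leadingPfaffian_congr fun a c hac hc => ?_
      simp [skipIndex, hc, hac.trans hc]
  · intro j hj
    rw [Finset.mem_range] at hj
    rw [h _ (by omega) (by omega)]
    simp

/-! ### Pfaffians of `H_n` with one row and column deleted -/

/-- The index `a` in the enumeration of the natural numbers different from `i`. -/
def omitIndex (i a : ℕ) : ℕ := if a < i then a else a + 1

/-- The Pfaffian of `H_n` without row and column `i`. -/
def deletedPfaffian (x y z : R) (n i : ℕ) : R :=
  leadingPfaffian (2 * n) fun a c =>
    buchsbaumEisenbudUpper x y z n (omitIndex i a) (omitIndex i c)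

theorem pfaffian_submatrix_buchsbaumEisenbudMatrix (x y z : R) (n : ℕ) (i : Fin (2 * n + 1)) :
    pfaffian (2 * n) ((buchsbaumEisenbudMatrix x y z n).submatrix i.succAbove i.succAbove) =
      deletedPfaffian x y z n i := by
  let f : ℕ → ℕ → R := fun a c =>
    if a < c then buchsbaumEisenbudUpper x y z n a c
    else if c < a then -buchsbaumEisenbudUpper x y z n c a else 0
  trans leadingPfaffian (2 * n) fun a c => f (omitIndex i a) (omitIndex i c)
  · rw [leadingPfaffian]
    congr 1
    ext a c
    simp only [buchsbaumEisenbudMatrix, f, omitIndex, Fin.lt_def, val_succAbove,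
      Matrix.submatrix_apply, Matrix.of_apply]
  · refine leadingPfaffian_congr fun a c hac hc => ?_
    refine if_pos ?_
    unfold omitIndex; split_ifs <;> omega

/-- Removing the outer rows and columns leaves a matrix of the same kind, but the shift by one
changes the parity of the rows and so exchanges `x` and `y`. -/
theorem buchsbaumEisenbudUpper_succ (x y z : R) (n a c : ℕ) :
    buchsbaumEisenbudUpper x y z (n + 1) (a + 1) (c + 1) =
      buchsbaumEisenbudUpper y x z n a c := by
  unfold buchsbaumEisenbudUpper
  have h1 : (c + 1 = a + 1 + 1) ↔ (c = a + 1) := by omega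
  have h2 : (a + 1 + (c + 1) = 2 * (n + 1)) ↔ (a + c = 2 * n) := by omega
  simp only [h1, h2, Nat.even_add_one]
  by_cases h : Even a <;> simp [h]

theorem buchsbaumEisenbudUpper_add_two (x y z : R) (n a c : ℕ) :
    buchsbaumEisenbudUpper x y z (n + 2) (a + 2) (c + 2) =
      buchsbaumEisenbudUpper x y z n a c := by
  rw [buchsbaumEisenbudUpper_succ, buchsbaumEisenbudUpper_succ]

theorem buchsbaumEisenbudUpper_eq_zero (x y z : R) {n a c : ℕ} (h : c ≠ a + 1)
    (h' : a + c ≠ 2 * n) : buchsbaumEisenbudUpper x y z n a c = 0 := by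
  simp [buchsbaumEisenbudUpper, h, h']

theorem buchsbaumEisenbudUpper_even (x y z : R) {n a : ℕ} (h : Even a) :
    buchsbaumEisenbudUpper x y z n a (a + 1) = x := by
  simp [buchsbaumEisenbudUpper, h]

theorem buchsbaumEisenbudUpper_odd (x y z : R) {n a : ℕ} (h : ¬ Even a) :
    buchsbaumEisenbudUpper x y z n a (a + 1) = y := by
  simp [buchsbaumEisenbudUpper, h]

theorem buchsbaumEisenbudUpper_antidiagonal (x y z : R) {n a c : ℕ} (h : a + c = 2 * n) :
    buchsbaumEisenbudUpper x y z n a c = z := by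
  have : c ≠ a + 1 := by omega
  simp [buchsbaumEisenbudUpper, this, h]

theorem deletedPfaffian_zero_left (x y z : R) (i : ℕ) : deletedPfaffian x y z 0 i = 1 := by
  simp [deletedPfaffian, leadingPfaffian_zero]

theorem deletedPfaffian_one_zero (x y z : R) : deletedPfaffian x y z 1 0 = y := by
  simp [deletedPfaffian, leadingPfaffian_add_two, leadingPfaffian_zero, omitIndex,
    buchsbaumEisenbudUpper]

theorem deletedPfaffian_one_one (x y z : R) : deletedPfaffian x y z 1 1 = z := by
  simp [deletedPfaffian, leadingPfaffian_add_two, leadingPfaffian_zero, omitIndex,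
    buchsbaumEisenbudUpper]

theorem deletedPfaffian_one_two (x y z : R) : deletedPfaffian x y z 1 2 = x := by
  simp [deletedPfaffian, leadingPfaffian_add_two, leadingPfaffian_zero, omitIndex,
    buchsbaumEisenbudUpper]

/-- The first term of the expansion of the Pfaffian along the first row. -/
theorem leadingPfaffian_omit_two (x y z : R) (n i : ℕ) (hi : i ≤ 2 * n) :
    leadingPfaffian (2 * n + 2) (fun a c => buchsbaumEisenbudUpper x y z (n + 2)
      (omitIndex (i + 2) (a + 2)) (omitIndex (i + 2) (c + 2))) =
      y * deletedPfaffian x y z n i := by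
  have h : ∀ a, omitIndex (i + 2) (a + 2) = omitIndex i a + 2 := by
    intro a; unfold omitIndex; split_ifs <;> omega
  simp only [h, buchsbaumEisenbudUpper_add_two]
  have h1 : omitIndex i (2 * n) = 2 * n + 1 := by
    unfold omitIndex; split_ifs <;> omega
  have h2 : omitIndex i (2 * n + 1) = 2 * n + 1 + 1 := by
    unfold omitIndex; split_ifs <;> omega
  -- The `z` of the last column sat in row `0`, which is gone; only the `y` from the superdiagonal
  -- is left.
  rw [leadingPfaffian_of_last_column, h1, h2, buchsbaumEisenbudUpper_odd, deletedPfaffian]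
  · simp
  · intro a ha
    rw [h2]
    apply buchsbaumEisenbudUpper_eq_zero <;> unfold omitIndex <;> split_ifs <;> omega

/-- Row `0` contains only `x`, next to the diagonal, and `z`, at the end. Choosing `z` removes the
first and last rows; choosing `x` forces `y` in the last column and leaves `H_n`. The bound on `i`
keeps the last two rows away from the deleted one. -/
theorem deletedPfaffian_add_two (x y z : R) (n i : ℕ) (hi : i ≤ 2 * n) :
    deletedPfaffian x y z (n + 2) (i + 2) =
      z * deletedPfaffian y x z (n + 1) (i + 1) + x * y * deletedPfaffian x y z n i := by
  rw [deletedPfaffian, show 2 * (n + 2) = 2 * n + 1 + 3 by ring, leadingPfaffian_of_first_row]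
  · have h1 : ∀ a, omitIndex (i + 2) (a + 1) = omitIndex (i + 1) a + 1 := by
      intro a; unfold omitIndex; split_ifs <;> omega
    rw [leadingPfaffian_omit_two x y z n i hi]
    have h2 : omitIndex (i + 2) 0 = 0 := by simp [omitIndex]
    have h3 : omitIndex (i + 2) 1 = 0 + 1 := by simp [omitIndex]
    have h4 : omitIndex (i + 2) (2 * n + 1 + 2) = 2 * (n + 2) := by
      unfold omitIndex; split_ifs <;> omega
    rw [h2, h3, h4, buchsbaumEisenbudUpper_even _ _ _ Even.zero,
      buchsbaumEisenbudUpper_antidiagonal _ _ _ (by omega)]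
    simp only [h1, buchsbaumEisenbudUpper_succ]
    rw [show (-1 : R) ^ (2 * n + 1 + 1) = 1 from Even.neg_one_pow ⟨n + 1, by ring⟩,
      deletedPfaffian.eq_def y x z (n + 1), show 2 * (n + 1) = 2 * n + 1 + 1 by ring]
    ring
  · intro c hc hc'
    apply buchsbaumEisenbudUpper_eq_zero <;> unfold omitIndex <;> split_ifs <;> omega

theorem deletedPfaffian_one (x y z : R) (n : ℕ) :
    deletedPfaffian x y z (n + 2) 1 = z * deletedPfaffian y x z (n + 1) 0 := by
  rw [deletedPfaffian, show 2 * (n + 2) = 2 * n + 1 + 3 by ring, leadingPfaffian_of_first_row]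
  · have h1 : ∀ a, omitIndex 1 (a + 1) = omitIndex 0 a + 1 := by
      intro a; simp [omitIndex]
    rw [buchsbaumEisenbudUpper_eq_zero x y z (a := omitIndex 1 0) (c := omitIndex 1 1)
        (by simp [omitIndex]) (by simp [omitIndex]),
      buchsbaumEisenbudUpper_antidiagonal x y z (by simp [omitIndex]; omega)]
    simp only [h1, buchsbaumEisenbudUpper_succ]
    rw [show (-1 : R) ^ (2 * n + 1 + 1) = 1 from Even.neg_one_pow ⟨n + 1, by ring⟩,
      deletedPfaffian.eq_def y x z (n + 1), show 2 * (n + 1) = 2 * n + 1 + 1 by ring]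
    ring
  · intro c hc hc'
    apply buchsbaumEisenbudUpper_eq_zero <;> unfold omitIndex <;> split_ifs <;> omega

/-- The deleted row carried the `y` of the last column, so choosing `x` in row `0` leaves a zero
column and only the `z` term survives. -/
theorem deletedPfaffian_last_but_one (x y z : R) (n : ℕ) :
    deletedPfaffian x y z (n + 2) (2 * n + 3) = z * deletedPfaffian y x z (n + 1) (2 * n + 2) := by
  rw [deletedPfaffian, show 2 * (n + 2) = 2 * n + 1 + 3 by ring, leadingPfaffian_of_first_row]
  · have h1 : ∀ a, omitIndex (2 * n + 3) (a + 1) = omitIndex (2 * n + 2) a + 1 := by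
      intro a; unfold omitIndex; split_ifs <;> omega
    have h4 : omitIndex (2 * n + 3) (2 * n + 1 + 2) = 2 * (n + 2) := by
      unfold omitIndex; split_ifs <;> omega
    rw [leadingPfaffian_of_last_column (m := 2 * n),
      buchsbaumEisenbudUpper_eq_zero x y z (a := omitIndex (2 * n + 3) (2 * n + 2)), h4,
      buchsbaumEisenbudUpper_antidiagonal x y z (a := omitIndex (2 * n + 3) 0)
        (c := 2 * (n + 2)) (by simp [omitIndex])]
    · simp only [h1, buchsbaumEisenbudUpper_succ]
      rw [show (-1 : R) ^ (2 * n + 1 + 1) = 1 from Even.neg_one_pow ⟨n + 1, by ring⟩,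
        deletedPfaffian, show 2 * (n + 1) = 2 * n + 1 + 1 by ring]
      ring
    · unfold omitIndex; split_ifs <;> omega
    · unfold omitIndex; split_ifs <;> omega
    · intro a ha
      apply buchsbaumEisenbudUpper_eq_zero <;> unfold omitIndex <;> split_ifs <;> omega
  · intro c hc hc'
    apply buchsbaumEisenbudUpper_eq_zero <;> unfold omitIndex <;> split_ifs <;> omega

theorem deletedPfaffian_last (x y z : R) (n : ℕ) :
    deletedPfaffian x y z n (2 * n) = x ^ n := by
  induction n using Nat.twoStepInduction with
  | zero => simp [deletedPfaffian_zero_left]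
  | one => simpa using deletedPfaffian_one_two x y z
  | more n ih _ =>
    have h0 : ∀ a, a < 2 * n + 4 → omitIndex (2 * (n + 2)) a = a := by
      intro a ha; unfold omitIndex; split_ifs <;> omega
    rw [deletedPfaffian, show 2 * (n + 2) = 2 * n + 1 + 3 by ring, leadingPfaffian_of_first_row]
    · rw [show 2 * n + 1 + 3 = 2 * (n + 2) by ring, h0 0 (by omega), h0 1 (by omega),
        buchsbaumEisenbudUpper_even x y z (n := n + 2) (a := 0) Even.zero,
        buchsbaumEisenbudUpper_eq_zero x y z (a := 0) (c := omitIndex (2 * (n + 2)) (2 * n + 1 + 2))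
          (by rw [h0 _ (by omega)]; omega) (by rw [h0 _ (by omega)]; omega)]
      have h2 : ∀ a, omitIndex (2 * (n + 2)) (a + 2) = omitIndex (2 * n + 2) a + 2 := by
        intro a; unfold omitIndex; split_ifs <;> omega
      simp only [h2, buchsbaumEisenbudUpper_add_two]
      -- With the last row deleted, the new last column has a single entry, the `x` in the row
      -- before it.
      rw [show 2 * n + 1 + 1 = 2 * n + 2 by ring, leadingPfaffian_of_last_column,
        show omitIndex (2 * n + 2) (2 * n) = 2 * n by simp [omitIndex],
        show omitIndex (2 * n + 2) (2 * n + 1) = 2 * n + 1 by simp [omitIndex],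
        buchsbaumEisenbudUpper_even x y z (by simp)]
      · have : deletedPfaffian x y z n (2 * n) = leadingPfaffian (2 * n) (fun a c =>
            buchsbaumEisenbudUpper x y z n (omitIndex (2 * n + 2) a)
              (omitIndex (2 * n + 2) c)) := by
          refine leadingPfaffian_congr fun a c hac hc => ?_
          have h3 : ∀ a, a < 2 * n → omitIndex (2 * n) a = omitIndex (2 * n + 2) a := by
            intro a ha; unfold omitIndex; split_ifs <;> omega
          rw [h3 a (by omega), h3 c hc]
        rw [← this, ih]
        ring
      · intro a ha
        apply buchsbaumEisenbudUpper_eq_zero <;> unfold omitIndex <;> split_ifs <;> omega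
    · intro c hc hc'
      apply buchsbaumEisenbudUpper_eq_zero <;> unfold omitIndex <;> split_ifs <;> omega

theorem deletedPfaffian_zero (x y z : R) (n : ℕ) :
    deletedPfaffian x y z n 0 = y ^ n := by
  induction n using Nat.twoStepInduction with
  | zero => simp [deletedPfaffian_zero_left]
  | one => simpa using deletedPfaffian_one_zero x y z
  | more n ih _ =>
    have h0 : ∀ a, omitIndex 0 a = a + 1 := by
      intro a; simp [omitIndex]
    simp only [deletedPfaffian, h0] at ih ⊢
    rw [show 2 * (n + 2) = 2 * n + 2 + 2 by ring, leadingPfaffian_of_last_column,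
      leadingPfaffian_of_first_row_single,
      buchsbaumEisenbudUpper_odd x y z (n := n + 2) (a := 0 + 1) (by simp),
      buchsbaumEisenbudUpper_odd x y z (by simp [Nat.even_add_one])]
    · simp only [show ∀ a, a + 2 + 1 = a + 1 + 2 by intro a; ring, buchsbaumEisenbudUpper_add_two]
      rw [ih]
      ring
    · intro c hc hc'
      apply buchsbaumEisenbudUpper_eq_zero <;> omega
    · intro a ha
      apply buchsbaumEisenbudUpper_eq_zero <;> omega

/-! ### Generators of the ideal in terms of the polynomials `F_i` -/

/-- The polynomials with `F_0 = 1`, `F_1 = z` and `F_{i+2} = z F_{i+1} + x y F_i`. -/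
def continuantPoly (x y z : R) : ℕ → R
  | 0 => 1
  | 1 => z
  | i + 2 => z * continuantPoly x y z (i + 1) + x * y * continuantPoly x y z i

theorem continuantPoly_swap (x y z : R) (i : ℕ) :
    continuantPoly y x z i = continuantPoly x y z i := by
  induction i using Nat.twoStepInduction with
  | zero => rfl
  | one => rfl
  | more i h1 h2 => rw [continuantPoly, continuantPoly, h1, h2, mul_comm y x]

/-- The recurrence for the Pfaffians is that of `F_i`, which is symmetric in `x` and `y`; the power
comes from the starting values at `i = 0` and `i = 1`. -/
theorem deletedPfaffian_add_left (x y z : R) (m i : ℕ) :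
    deletedPfaffian x y z (i + m) i =
      (if Even i then y else x) ^ m * continuantPoly x y z i := by
  induction i using Nat.twoStepInduction generalizing x y with
  | zero => simp [deletedPfaffian_zero, continuantPoly]
  | one =>
    rcases m with _ | m
    · simp [deletedPfaffian_one_one, continuantPoly]
    · rw [show 1 + (m + 1) = m + 2 by ring, deletedPfaffian_one, deletedPfaffian_zero]
      simp [continuantPoly, mul_comm]
  | more i h1 h2 =>
    rw [show i + 2 + m = i + m + 2 by ring, deletedPfaffian_add_two _ _ _ _ _ (by omega), h1,
      show i + m + 1 = i + 1 + m by ring, h2, continuantPoly, continuantPoly_swap x y z (i + 1)]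
    by_cases h : Even i <;> simp [h, Nat.even_add_one] <;> ring

theorem deletedPfaffian_add_right (x y z : R) (m i : ℕ) :
    deletedPfaffian x y z (i + m) (i + 2 * m) =
      (if Even i then x else y) ^ m * continuantPoly x y z i := by
  induction i using Nat.twoStepInduction generalizing x y with
  | zero => simp [deletedPfaffian_last, continuantPoly]
  | one =>
    rcases m with _ | m
    · simp [deletedPfaffian_one_one, continuantPoly]
    · rw [show 1 + (m + 1) = m + 2 by ring, show 1 + 2 * (m + 1) = 2 * m + 3 by ring,
        deletedPfaffian_last_but_one, show 2 * m + 2 = 2 * (m + 1) by ring, deletedPfaffian_last]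
      simp [continuantPoly, mul_comm]
  | more i h1 h2 =>
    rw [show i + 2 + m = i + m + 2 by ring, show i + 2 + 2 * m = i + 2 * m + 2 by ring,
      deletedPfaffian_add_two _ _ _ _ _ (by omega), h1,
      show i + m + 1 = i + 1 + m by ring, show i + 2 * m + 1 = i + 1 + 2 * m by ring, h2,
      continuantPoly, continuantPoly_swap x y z (i + 1)]
    by_cases h : Even i <;> simp [h, Nat.even_add_one] <;> ring

/-- Deleting row `i` or its mirror image `2n - i`, with `i ≤ n`, gives the same `F_i` with a power
of `x` in one case and of `y` in the other. Which one is which depends on the parity of `i`, but the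
set does not. -/
theorem buchsbaumEisenbudIdeal_eq_span (x y z : R) (n : ℕ) :
    buchsbaumEisenbudIdeal x y z n = Ideal.span {r | ∃ m i, i + m = n ∧
      (r = x ^ m * continuantPoly x y z i ∨ r = y ^ m * continuantPoly x y z i)} := by
  rw [buchsbaumEisenbudIdeal]
  simp only [pfaffian_submatrix_buchsbaumEisenbudMatrix]
  congr 1
  ext r
  simp only [Set.mem_range, Set.mem_ofPred_eq]
  constructor
  · rintro ⟨⟨i, hi⟩, rfl⟩
    rcases le_total i n with h | h
    · obtain ⟨m, rfl⟩ := Nat.exists_eq_add_of_le h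
      refine ⟨m, i, rfl, ?_⟩
      rw [deletedPfaffian_add_left]
      by_cases h : Even i <;> simp [h]
    · obtain ⟨j, hj⟩ := Nat.exists_eq_add_of_le (show i ≤ 2 * n by omega)
      obtain ⟨m, rfl⟩ := Nat.exists_eq_add_of_le (show j ≤ n by omega)
      obtain rfl : i = j + 2 * m := by omega
      refine ⟨m, j, rfl, ?_⟩
      rw [deletedPfaffian_add_right]
      by_cases h : Even j <;> simp [h]
  · rintro ⟨m, i, rfl, h⟩
    have hl := deletedPfaffian_add_left x y z m i
    have hr := deletedPfaffian_add_right x y z m i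
    by_cases hi : Even i
    · rw [if_pos hi] at hl hr
      rcases h with rfl | rfl
      · exact ⟨⟨i + 2 * m, by omega⟩, hr⟩
      · exact ⟨⟨i, by omega⟩, hl⟩
    · rw [if_neg hi] at hl hr
      rcases h with rfl | rfl
      · exact ⟨⟨i, by omega⟩, hl⟩
      · exact ⟨⟨i + 2 * m, by omega⟩, hr⟩

theorem pow_mul_pow_mul_continuantPoly_mem (x y z : R) {n a c i : ℕ} (h : n ≤ max a c + i) :
    x ^ a * y ^ c * continuantPoly x y z i ∈ buchsbaumEisenbudIdeal x y z n := by
  rw [buchsbaumEisenbudIdeal_eq_span]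
  induction i using Nat.strong_induction_on generalizing a c with
  | _ i ih =>
  by_cases hi : i ≤ n
  · obtain ⟨m, rfl⟩ := Nat.exists_eq_add_of_le hi
    rcases le_max_iff.1 (show m ≤ max a c by omega) with hm | hm
    · obtain ⟨d, rfl⟩ := Nat.exists_eq_add_of_le hm
      rw [show x ^ (m + d) * y ^ c * continuantPoly x y z i =
        (x ^ d * y ^ c) * (x ^ m * continuantPoly x y z i) by ring]
      exact Ideal.mul_mem_left _ _ (Ideal.subset_span ⟨m, i, rfl, Or.inl rfl⟩)
    · obtain ⟨d, rfl⟩ := Nat.exists_eq_add_of_le hm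
      rw [show x ^ a * y ^ (m + d) * continuantPoly x y z i =
        (x ^ a * y ^ d) * (y ^ m * continuantPoly x y z i) by ring]
      exact Ideal.mul_mem_left _ _ (Ideal.subset_span ⟨m, i, rfl, Or.inr rfl⟩)
  -- For `i > n` the recurrence lowers the index: `z F_{i+1}` drops it by one, and `x y F_i` drops
  -- it by two but raises both exponents. The bound survives both ways.
  · rcases i with _ | _ | i
    · omega
    · rw [show x ^ a * y ^ c * continuantPoly x y z (0 + 1) =
        z * (x ^ a * y ^ c * continuantPoly x y z 0) by simp [continuantPoly]; ring]
      exact Ideal.mul_mem_left _ _ (ih 0 (by omega) (by omega))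
    · rw [continuantPoly, show x ^ a * y ^ c * (z * continuantPoly x y z (i + 1) +
          x * y * continuantPoly x y z i) = z * (x ^ a * y ^ c * continuantPoly x y z (i + 1)) +
          x ^ (a + 1) * y ^ (c + 1) * continuantPoly x y z i by ring]
      exact Ideal.add_mem _ (Ideal.mul_mem_left _ _ (ih _ (by omega) (by omega)))
        (ih _ (by omega) (by omega))

end Pfaffians

section InverseSystem

variable {k : Type*} [Field k] {U : Type*} [AddCommGroup U] [Module k U]

open DividedPowerAlgebra

/-! ### The pairing of `Sym(U)` and `D(U*)` -/

variable (k U) in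
/-- The projection of `D(U*)` onto its degree zero component. -/
def augmentation : DualDP k U →ₐ[k] k :=
  lift' (f := fun p : ℕ × Module.Dual k U => if p.1 = 0 then 1 else 0)
    (fun m => by simp)
    (fun n r m => by by_cases h : n = 0 <;> simp [h])
    (fun n p m => by by_cases h : n = 0 <;> by_cases h' : p = 0 <;> simp [h, h'])
    (fun n u v => by
      rcases n with _ | n
      · simp
      · symm
        simp only [Nat.add_eq_zero_iff, one_ne_zero, and_false, if_false]
        refine Finset.sum_eq_zero fun p hp => ?_
        rw [Finset.HasAntidiagonal.mem_antidiagonal] at hp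
        by_cases h : p.1 = 0
        · have : p.2 ≠ 0 := by omega
          simp [this]
        · simp [h])

theorem augmentation_dp (n : ℕ) (w : Module.Dual k U) :
    augmentation k U (dp k n w) = if n = 0 then 1 else 0 := by
  simp [augmentation]

/-- The pairing `r ↦ ε(r w)` of `Sym(U)` with an element `w` of `D(U*)`. -/
def pairing (w : DualDP k U) : SymmetricAlgebra k U →ₗ[k] k :=
  (augmentation k U).toLinearMap ∘ₗ LinearMap.applyₗ w ∘ₗ (contractAlgHom k U).toLinearMap

theorem pairing_apply (w : DualDP k U) (r : SymmetricAlgebra k U) :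
    pairing w r = augmentation k U (r • w) := rfl

theorem pairing_smul_left (w : DualDP k U) (r s : SymmetricAlgebra k U) :
    pairing (s • w) r = pairing w (r * s) := by
  rw [pairing_apply, pairing_apply, mul_smul]

theorem smul_smul_of_field (c : k) (r : SymmetricAlgebra k U) (w : DualDP k U) :
    (c • r) • w = c • (r • w) := by
  simp [smul_def]

theorem smul_comm_of_field (c : k) (r : SymmetricAlgebra k U) (w : DualDP k U) :
    r • (c • w) = c • (r • w) := by
  simp [smul_def]

theorem pairing_sub (w w' : DualDP k U) (r : SymmetricAlgebra k U) :
    pairing (w - w') r = pairing w r - pairing w' r := by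
  simp [pairing_apply, smul_sub]

theorem pairing_sum_smul {ι : Type*} (s : Finset ι) (c : ι → k) (f : ι → DualDP k U)
    (r : SymmetricAlgebra k U) :
    pairing (∑ i ∈ s, c i • f i) r = ∑ i ∈ s, c i * pairing (f i) r := by
  simp [pairing_apply, Finset.smul_sum, smul_comm_of_field]

variable (b : Module.Basis (Fin 3) k U)

theorem contract_dp_of_apply_eq_zero {v : U} {w : Module.Dual k U} (h : w v = 0) (n : ℕ) :
    contract v (dp k n w) = 0 := by
  cases n <;> simp [h]

/-- The monomial `x*^{(p)} y*^{(q)} z*^{(r)}`. -/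
def dpMonomial (p q r : ℕ) : DualDP k U :=
  dp k p (b.coord 0) * dp k q (b.coord 1) * dp k r (b.coord 2)

theorem ι_zero_smul_dpMonomial (p q r : ℕ) :
    SymmetricAlgebra.ι k U (b 0) • dpMonomial b p q r =
      if p = 0 then 0 else dpMonomial b (p - 1) q r := by
  rw [ι_smul, dpMonomial, dpMonomial, Derivation.leibniz, Derivation.leibniz,
    contract_dp_of_apply_eq_zero (w := b.coord 1) (by simp),
    contract_dp_of_apply_eq_zero (w := b.coord 2) (by simp)]
  rcases p with _ | p
  · simp
  · simp [mul_comm]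

theorem ι_one_smul_dpMonomial (p q r : ℕ) :
    SymmetricAlgebra.ι k U (b 1) • dpMonomial b p q r =
      if q = 0 then 0 else dpMonomial b p (q - 1) r := by
  rw [ι_smul, dpMonomial, dpMonomial, Derivation.leibniz, Derivation.leibniz,
    contract_dp_of_apply_eq_zero (w := b.coord 0) (by simp),
    contract_dp_of_apply_eq_zero (w := b.coord 2) (by simp)]
  rcases q with _ | q
  · simp
  · simp [mul_comm]

theorem ι_two_smul_dpMonomial (p q r : ℕ) :
    SymmetricAlgebra.ι k U (b 2) • dpMonomial b p q r =
      if r = 0 then 0 else dpMonomial b p q (r - 1) := by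
  rw [ι_smul, dpMonomial, dpMonomial, Derivation.leibniz, Derivation.leibniz,
    contract_dp_of_apply_eq_zero (w := b.coord 0) (by simp),
    contract_dp_of_apply_eq_zero (w := b.coord 1) (by simp)]
  rcases r with _ | r
  · simp
  · simp [mul_comm]

/-- The monomial `x^a y^c z^d`. -/
def symMonomial (a c d : ℕ) : SymmetricAlgebra k U :=
  SymmetricAlgebra.ι k U (b 0) ^ a * SymmetricAlgebra.ι k U (b 1) ^ c *
    SymmetricAlgebra.ι k U (b 2) ^ d

/-- Divided powers make the two monomial bases exactly dual, without factorials; this is why the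
characteristic plays no role. -/
theorem pairing_dpMonomial (a c d p q r : ℕ) :
    pairing (dpMonomial b p q r) (symMonomial b a c d) =
      if a = p ∧ c = q ∧ d = r then 1 else 0 := by
  rw [pairing_apply, symMonomial]
  induction d generalizing r with
  | succ d ih =>
    rw [pow_succ, ← mul_assoc, mul_smul, ι_two_smul_dpMonomial]
    rcases r with _ | r
    · simp
    · simpa using ih r
  | zero =>
  rw [pow_zero, mul_one]
  induction c generalizing q with
  | succ c ih =>
    rw [pow_succ, ← mul_assoc, mul_smul, ι_one_smul_dpMonomial]
    rcases q with _ | q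
    · simp
    · simpa using ih q
  | zero =>
  rw [pow_zero, mul_one]
  induction a generalizing p with
  | succ a ih =>
    rw [pow_succ, mul_smul, ι_zero_smul_dpMonomial]
    rcases p with _ | p
    · simp
    · simpa using ih p
  | zero =>
    simp only [pow_zero, one_smul, dpMonomial, map_mul, augmentation_dp]
    rcases p with _ | p <;> rcases q with _ | q <;> rcases r with _ | r <;> simp

/-- The pairing of `Sym(U)` and `D(U*)` is non-degenerate on the right. -/
theorem eq_zero_of_pairing_eq_zero (b : Module.Basis (Fin 3) k U) {w : DualDP k U}
    (h : ∀ r, pairing w r = 0) : w = 0 := by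
  have hspan := submodule_span_prod_dp_eq_top (R := k) (v := b.dualBasis)
    b.dualBasis.span_eq
  have hw : w ∈ Submodule.span k (Set.range fun n : Fin 3 →₀ ℕ =>
      n.prod fun i a => dp k a (b.dualBasis i)) := by
    rw [hspan]; trivial
  have hmon : ∀ n : Fin 3 →₀ ℕ, (n.prod fun i a => dp k a (b.dualBasis i)) =
      dpMonomial b (n 0) (n 1) (n 2) := by
    intro n
    rw [Finsupp.prod_fintype n (fun i a => dp k a (b.dualBasis i)) fun i => dp_zero,
      Fin.prod_univ_three]
    simp [dpMonomial]
  simp only [hmon] at hw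
  obtain ⟨c, rfl⟩ := Finsupp.mem_span_range_iff_exists_finsupp.1 hw
  have hc : ∀ n, c n = 0 := by
    intro n
    have := h (symMonomial b (n 0) (n 1) (n 2))
    rw [Finsupp.sum, pairing_sum_smul, Finset.sum_eq_single n] at this
    · simpa [pairing_dpMonomial] using this
    · intro m _ hm
      rw [pairing_dpMonomial, if_neg, mul_zero]
      rintro ⟨h0, h1, h2⟩
      apply hm
      ext i
      fin_cases i <;> simp [h0, h1, h2]
    · intro hn
      simp [Finsupp.notMem_support_iff.1 hn]
  simp [Finsupp.sum, hc]

/-- The elements of `D(U*)` that are killed by `U` are constants. -/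
theorem eq_algebraMap_of_contract_eq_zero (b : Module.Basis (Fin 3) k U) {w : DualDP k U}
    (h : ∀ u : U, SymmetricAlgebra.ι k U u • w = 0) :
    w = algebraMap k _ (augmentation k U w) := by
  -- On elements killed by `U`, a polynomial acts through its constant term `c`. This applies to `w
  -- - ε(w)`, whose augmentation is `0`.
  have key : ∀ r : SymmetricAlgebra k U, ∃ c : k, ∀ w' : DualDP k U,
      (∀ u : U, SymmetricAlgebra.ι k U u • w' = 0) → r • w' = c • w' := by
    intro r
    induction r using SymmetricAlgebra.induction with
    | algebraMap c => exact ⟨c, fun w' _ => by simp [smul_def]⟩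
    | ι u => exact ⟨0, fun w' hw' => by rw [hw', zero_smul]⟩
    | mul r s hr hs =>
      obtain ⟨c, hc⟩ := hr
      obtain ⟨d, hd⟩ := hs
      exact ⟨d * c, fun w' hw' => by
        rw [mul_smul, hd w' hw', smul_comm_of_field, hc w' hw', mul_smul]⟩
    | add r s hr hs =>
      obtain ⟨c, hc⟩ := hr
      obtain ⟨d, hd⟩ := hs
      exact ⟨c + d, fun w' hw' => by rw [add_smul, hc w' hw', hd w' hw', add_smul]⟩
  rw [← sub_eq_zero]
  refine eq_zero_of_pairing_eq_zero b fun r => ?_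
  obtain ⟨c, hc⟩ := key r
  rw [pairing_apply, hc _ fun u => by
    rw [smul_sub, h u, ι_smul, Derivation.map_algebraMap, sub_zero]]
  simp

/-! ### The values of the pairing with `φ_n` -/

theorem phi_eq (n : ℕ) : phi b n = ∑ i ∈ Finset.range n, ((-1) ^ i * (catalan i : k)) •
    dpMonomial b (n - 1 - i) (n - 1 - i) (2 * i) := rfl

theorem pairing_phi_symMonomial (n a c d : ℕ) :
    pairing (phi b n) (symMonomial b a c d) =
      if a = c ∧ 2 * a + d + 2 = 2 * n then (-1) ^ (d / 2) * (catalan (d / 2) : k) else 0 := by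
  rw [phi_eq, pairing_sum_smul]
  simp only [pairing_dpMonomial]
  split_ifs with h
  · rw [Finset.sum_eq_single (d / 2)]
    · rw [if_pos (by omega), mul_one]
    · intro i hi hne
      rw [if_neg (by omega), mul_zero]
    · intro hd
      rw [Finset.mem_range] at hd
      omega
  · refine Finset.sum_eq_zero fun i hi => ?_
    rw [Finset.mem_range] at hi
    rw [if_neg (by omega), mul_zero]

/-! ### Ballot numbers and the orthogonality of the `F_i` -/

/-- The signed ballot numbers. -/
def signedBallot (d i : ℕ) : ℤ :=
  (-1) ^ ((d + i) / 2) * (d.choose ((d + i) / 2) - d.choose ((d + i) / 2 + 1))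

/-- The counterpart of `F_{i+2} = z F_{i+1} + x y F_i`, by Pascal's rule. It holds for the rounded
halves as well, although only even `d + i` matters. -/
theorem signedBallot_add_two (d i : ℕ) :
    signedBallot d (i + 2) = signedBallot (d + 1) (i + 1) + signedBallot d i := by
  unfold signedBallot
  rw [show (d + (i + 2)) / 2 = (d + i) / 2 + 1 by omega,
    show (d + 1 + (i + 1)) / 2 = (d + i) / 2 + 1 by omega, Nat.choose_succ_succ,
    Nat.choose_succ_succ]
  push_cast
  ring

theorem signedBallot_zero (s : ℕ) : signedBallot (2 * s) 0 = (-1) ^ s * catalan s := by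
  have h1 := succ_mul_catalan_eq_centralBinom s
  rw [Nat.centralBinom] at h1
  have h2 := Nat.choose_succ_right_eq (2 * s) s
  rw [show 2 * s - s = s by omega] at h2
  unfold signedBallot
  rw [show (2 * s + 0) / 2 = s by omega]
  congr 1
  have h3 : ((s : ℤ) + 1) ≠ 0 := by positivity
  apply mul_left_cancel₀ h3
  zify at h1 h2
  linear_combination -h1 - h2

theorem signedBallot_one (s : ℕ) : signedBallot (2 * s + 1) 1 = signedBallot (2 * s + 2) 0 := by
  unfold signedBallot
  rw [add_zero, show (2 * s + 1 + 1) / 2 = s + 1 by omega,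
    Nat.choose_succ_succ (2 * s + 1), Nat.choose_succ_succ (2 * s + 1),
    ← Nat.choose_symm_half s]
  push_cast
  ring

theorem signedBallot_self (i : ℕ) : signedBallot i i = (-1) ^ i := by
  unfold signedBallot
  rw [show (i + i) / 2 = i by omega]
  simp

theorem signedBallot_eq_zero {d i : ℕ} (h : d + 2 ≤ i) : signedBallot d i = 0 := by
  unfold signedBallot
  rw [Nat.choose_eq_zero_of_lt (by omega), Nat.choose_eq_zero_of_lt (by omega)]
  simp

/-- `F_i(x, y, z)` in `Sym(U)`. -/
def symContinuant (i : ℕ) : SymmetricAlgebra k U :=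
  continuantPoly (SymmetricAlgebra.ι k U (b 0)) (SymmetricAlgebra.ι k U (b 1))
    (SymmetricAlgebra.ι k U (b 2)) i

theorem symMonomial_mul_symContinuant_add_two (a c d i : ℕ) :
    symMonomial b a c d * symContinuant b (i + 2) =
      symMonomial b a c (d + 1) * symContinuant b (i + 1) +
        symMonomial b (a + 1) (c + 1) d * symContinuant b i := by
  simp only [symMonomial, symContinuant, continuantPoly]
  ring

theorem symMonomial_mul_symContinuant_one (a c d : ℕ) :
    symMonomial b a c d * symContinuant b 1 = symMonomial b a c (d + 1) := by
  simp only [symMonomial, symContinuant, continuantPoly]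
  ring

theorem symContinuant_zero : symContinuant b 0 = 1 := rfl

/-- Both sides satisfy the same recurrence in `i`; the starting values are Catalan numbers, by
`signedBallot_zero` and `signedBallot_one`. -/
theorem pairing_phi_symMonomial_mul (n a c d i : ℕ) :
    pairing (phi b n) (symMonomial b a c d * symContinuant b i) =
      if a = c ∧ 2 * a + d + i + 2 = 2 * n then (signedBallot d i : k) else 0 := by
  induction i using Nat.twoStepInduction generalizing a c d with
  | zero =>
    rw [symContinuant_zero, mul_one, pairing_phi_symMonomial]
    by_cases h : a = c ∧ 2 * a + d + 2 = 2 * n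
    · obtain ⟨s, rfl⟩ : ∃ s, d = 2 * s := ⟨n - a - 1, by omega⟩
      rw [if_pos h, if_pos h, signedBallot_zero, show 2 * s / 2 = s by omega]
      simp
    · rw [if_neg h, if_neg h]
  | one =>
    rw [symMonomial_mul_symContinuant_one, pairing_phi_symMonomial,
      show 2 * a + d + 1 + 2 = 2 * a + (d + 1) + 2 by ring]
    by_cases h : a = c ∧ 2 * a + (d + 1) + 2 = 2 * n
    · obtain ⟨s, rfl⟩ : ∃ s, d = 2 * s + 1 := ⟨n - a - 2, by omega⟩
      rw [if_pos h, if_pos h, signedBallot_one, show 2 * s + 2 = 2 * (s + 1) by ring,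
        signedBallot_zero, show 2 * (s + 1) / 2 = s + 1 by omega]
      simp
    · rw [if_neg h, if_neg h]
  | more i h1 h2 =>
    rw [symMonomial_mul_symContinuant_add_two, map_add, h1, h2, signedBallot_add_two]
    by_cases h : a = c ∧ 2 * a + d + (i + 2) + 2 = 2 * n
    · rw [if_pos h, if_pos (by omega), if_pos (by omega)]
      push_cast
      ring
    · rw [if_neg h, if_neg (by omega), if_neg (by omega), add_zero]

/-- Orthogonality: `F_j` annihilates lower powers of `z`, so only the leading term `z^i` of `F_i`
can contribute, and only if `d + i = j`. -/
theorem pairing_phi_symMonomial_mul_mul (n a c d i j : ℕ) (h : d + i ≤ j) :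
    pairing (phi b n) (symMonomial b a c d * symContinuant b i * symContinuant b j) =
      if d + i = j ∧ a = c ∧ a + j + 1 = n then (-1) ^ j else 0 := by
  have h0 : ∀ a c d, d ≤ j → pairing (phi b n) (symMonomial b a c d * symContinuant b j) =
      if d = j ∧ a = c ∧ a + j + 1 = n then (-1) ^ j else 0 := by
    intro a c d hd
    rw [pairing_phi_symMonomial_mul]
    by_cases h1 : a = c ∧ 2 * a + d + j + 2 = 2 * n
    · rw [if_pos h1]
      by_cases h2 : d = j
      · subst h2
        rw [if_pos (by omega), signedBallot_self]
        simp
      -- Here `d < j`, and `h1` makes `d` and `j` of equal parity, so `d + 2 ≤ j`.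
      · rw [if_neg (by omega), signedBallot_eq_zero (by omega)]
        simp
    · rw [if_neg h1, if_neg (by omega)]
  induction i using Nat.twoStepInduction generalizing a c d with
  | zero => rw [symContinuant_zero, mul_one, h0 _ _ _ (by omega), add_zero]
  | one => rw [symMonomial_mul_symContinuant_one, h0 _ _ _ h]
  | more i h1 h2 =>
    rw [symMonomial_mul_symContinuant_add_two, add_mul, map_add, h2 _ _ _ (by omega),
      h1 _ _ _ (by omega), if_neg (show ¬ (d + i = j ∧ _) by omega), add_zero]
    refine if_congr (by omega) rfl rfl

/-- The element `x^a y^c F_i` of `Sym(U)`. -/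
def continuantBasis (p : ℕ × ℕ × ℕ) : SymmetricAlgebra k U :=
  SymmetricAlgebra.ι k U (b 0) ^ p.1 * SymmetricAlgebra.ι k U (b 1) ^ p.2.1 *
    symContinuant b p.2.2

theorem pairing_phi_continuantBasis_mul (n : ℕ) (p q : ℕ × ℕ × ℕ) :
    pairing (phi b n) (continuantBasis b p * continuantBasis b q) =
      if p.2.2 = q.2.2 ∧ p.1 + q.1 = p.2.1 + q.2.1 ∧ p.1 + q.1 + q.2.2 + 1 = n
        then (-1) ^ q.2.2 else 0 := by
  rcases le_total p.2.2 q.2.2 with h | h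
  · have := pairing_phi_symMonomial_mul_mul b n (p.1 + q.1) (p.2.1 + q.2.1) 0 p.2.2 q.2.2
      (by omega)
    rw [zero_add] at this
    rw [← this, continuantBasis, continuantBasis, symMonomial]
    congr 1
    ring
  · have := pairing_phi_symMonomial_mul_mul b n (p.1 + q.1) (p.2.1 + q.2.1) 0 q.2.2 p.2.2
      (by omega)
    rw [zero_add] at this
    trans if q.2.2 = p.2.2 ∧ p.1 + q.1 = p.2.1 + q.2.1 ∧ p.1 + q.1 + p.2.2 + 1 = n
        then (-1) ^ p.2.2 else 0
    · rw [← this, continuantBasis, continuantBasis, symMonomial]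
      congr 1
      ring
    · by_cases hpq : p.2.2 = q.2.2
      · simp only [hpq]
      · rw [if_neg (by omega), if_neg (by omega)]

end InverseSystem

/-! ### The dual system for `φ_n` and the main theorem -/

section MainResult

variable {k : Type*} [Field k] {U : Type*} [AddCommGroup U] [Module k U]
  (b : Module.Basis (Fin 3) k U)

open DividedPowerAlgebra

theorem ι_mul_mem (N : Submodule k (SymmetricAlgebra k U)) {s : SymmetricAlgebra k U}
    (h : ∀ i, SymmetricAlgebra.ι k U (b i) * s ∈ N) (u : U) :
    SymmetricAlgebra.ι k U u * s ∈ N := by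
  rw [← b.sum_repr u, map_sum, Finset.sum_mul]
  refine N.sum_mem fun i _ => ?_
  rw [map_smul, smul_mul_assoc]
  exact N.smul_mem _ (h i)

theorem ι_zero_mul_continuantBasis (a c i : ℕ) :
    SymmetricAlgebra.ι k U (b 0) * continuantBasis b (a, c, i) =
      continuantBasis b (a + 1, c, i) := by
  simp only [continuantBasis]
  ring

theorem ι_one_mul_continuantBasis (a c i : ℕ) :
    SymmetricAlgebra.ι k U (b 1) * continuantBasis b (a, c, i) =
      continuantBasis b (a, c + 1, i) := by
  simp only [continuantBasis]
  ring

theorem ι_two_mul_continuantBasis_zero (a c : ℕ) :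
    SymmetricAlgebra.ι k U (b 2) * continuantBasis b (a, c, 0) =
      continuantBasis b (a, c, 1) := by
  simp only [continuantBasis, symContinuant, continuantPoly]
  ring

theorem ι_two_mul_continuantBasis_succ (a c i : ℕ) :
    SymmetricAlgebra.ι k U (b 2) * continuantBasis b (a, c, i + 1) =
      continuantBasis b (a, c, i + 2) - continuantBasis b (a + 1, c + 1, i) := by
  simp only [continuantBasis, symContinuant, continuantPoly]
  ring

theorem continuantBasis_zero : continuantBasis b (0, 0, 0) = 1 := by
  simp [continuantBasis, symContinuant_zero]

/-- The span contains `1` and is stable under `x`, `y` and `z`, the last because `z F_{i+1} =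
F_{i+2} - x y F_i`. -/
theorem span_continuantBasis :
    Submodule.span k (Set.range (continuantBasis b)) = ⊤ := by
  set S := Submodule.span k (Set.range (continuantBasis b))
  have hmem : ∀ p, continuantBasis b p ∈ S := fun p => Submodule.subset_span ⟨p, rfl⟩
  have hι : ∀ u, ∀ s ∈ S, SymmetricAlgebra.ι k U u * s ∈ S := by
    intro u s hs
    refine ι_mul_mem b S (fun j => ?_) u
    induction hs using Submodule.span_induction with
    | zero => rw [mul_zero]; exact S.zero_mem
    | add r s _ _ hr hs => rw [mul_add]; exact S.add_mem hr hs
    | smul c r _ hr => rw [mul_smul_comm]; exact S.smul_mem _ hr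
    | mem s hs =>
      obtain ⟨⟨a, c, i⟩, rfl⟩ := hs
      fin_cases j
      · exact (ι_zero_mul_continuantBasis b a c i).symm ▸ hmem _
      · exact (ι_one_mul_continuantBasis b a c i).symm ▸ hmem _
      · rcases i with _ | i
        · exact (ι_two_mul_continuantBasis_zero b a c).symm ▸ hmem _
        · exact (ι_two_mul_continuantBasis_succ b a c i).symm ▸ S.sub_mem (hmem _) (hmem _)
  have hmul : ∀ r s : SymmetricAlgebra k U, s ∈ S → r * s ∈ S := by
    intro r
    induction r using SymmetricAlgebra.induction with
    | algebraMap c =>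
      intro s hs
      rw [← Algebra.smul_def]
      exact S.smul_mem _ hs
    | ι u => exact hι u
    | mul r r' hr hr' =>
      intro s hs
      rw [mul_assoc]
      exact hr _ (hr' _ hs)
    | add r r' hr hr' =>
      intro s hs
      rw [add_mul]
      exact S.add_mem (hr _ hs) (hr' _ hs)
  refine eq_top_iff.2 fun r _ => ?_
  rw [← mul_one r, ← continuantBasis_zero b]
  exact hmul r _ (hmem _)

theorem continuantBasis_mem_BE {n : ℕ} {p : ℕ × ℕ × ℕ} (h : n ≤ max p.1 p.2.1 + p.2.2) :
    continuantBasis b p ∈ BE b n :=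
  pow_mul_pow_mul_continuantPoly_mem _ _ _ h

/-- A non-zero pairing with another `x^a y^c F_i` needs both total exponents equal to `n - 1 - i`,
which the hypothesis rules out. -/
theorem continuantBasis_smul_phi {n : ℕ} {p : ℕ × ℕ × ℕ} (h : n ≤ max p.1 p.2.1 + p.2.2) :
    continuantBasis b p • phi b n = 0 := by
  refine eq_zero_of_pairing_eq_zero b fun r => ?_
  suffices pairing (continuantBasis b p • phi b n) = 0 by rw [this]; rfl
  refine LinearMap.ext_on_range (span_continuantBasis b) fun q => ?_
  rw [pairing_smul_left, pairing_phi_continuantBasis_mul, if_neg (by omega)]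
  rfl

theorem BE_eq_span (n : ℕ) : BE b n = Ideal.span {r | ∃ m i, i + m = n ∧
    (r = SymmetricAlgebra.ι k U (b 0) ^ m * symContinuant b i ∨
      r = SymmetricAlgebra.ι k U (b 1) ^ m * symContinuant b i)} :=
  buchsbaumEisenbudIdeal_eq_span _ _ _ n

theorem smul_phi_eq_zero_of_mem {n : ℕ} {r : SymmetricAlgebra k U} (hr : r ∈ BE b n) :
    r • phi b n = 0 := by
  suffices BE b n ≤ Ideal.torsionOf _ _ (phi b n) from (Ideal.mem_torsionOf_iff _ _).1 (this hr)
  rw [BE_eq_span, Ideal.span_le]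
  rintro _ ⟨m, i, rfl, rfl | rfl⟩
  · have := continuantBasis_smul_phi b (n := i + m) (p := (m, 0, i)) (by simp; omega)
    simpa [continuantBasis] using this
  · have := continuantBasis_smul_phi b (n := i + m) (p := (0, m, i)) (by simp; omega)
    simpa [continuantBasis] using this

/-- The exponents of the elements `x^a y^c F_i` that give a basis of `Sym(U)/BE_n`. -/
def standardExponents (n : ℕ) : Finset (ℕ × ℕ × ℕ) :=
  {p ∈ Finset.range n ×ˢ Finset.range n ×ˢ Finset.range n | max p.1 p.2.1 + p.2.2 < n}

theorem mem_standardExponents {n : ℕ} {p : ℕ × ℕ × ℕ} :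
    p ∈ standardExponents n ↔ max p.1 p.2.1 + p.2.2 < n := by
  simp only [standardExponents, Finset.mem_filter, Finset.mem_product, Finset.mem_range]
  omega

/-- The exponent whose basis element is dual to that of `p`, up to sign. -/
def dualExponent (n : ℕ) (p : ℕ × ℕ × ℕ) : ℕ × ℕ × ℕ :=
  (n - 1 - p.2.2 - p.1, n - 1 - p.2.2 - p.2.1, p.2.2)

theorem pairing_phi_mul_dualExponent {n : ℕ} (p : ℕ × ℕ × ℕ) {q : ℕ × ℕ × ℕ}
    (hq : q ∈ standardExponents n) :
    pairing (phi b n) (continuantBasis b p * continuantBasis b (dualExponent n q)) =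
      if p = q then (-1) ^ q.2.2 else 0 := by
  rw [mem_standardExponents] at hq
  rw [pairing_phi_continuantBasis_mul]
  refine if_congr ?_ rfl rfl
  -- The truncated subtractions in `dualExponent` are exact because `q` is standard.
  simp only [dualExponent, Prod.ext_iff]
  omega

/-- Every element of `Sym(U)` is congruent to a combination of standard basis elements, with
coefficients that are given by the pairing with `φ_n`. -/
theorem mk_eq_sum (n : ℕ) (r : SymmetricAlgebra k U) :
    Ideal.Quotient.mk (BE b n) r = ∑ q ∈ standardExponents n,
      ((-1) ^ q.2.2 * pairing (phi b n) (r * continuantBasis b (dualExponent n q))) •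
        Ideal.Quotient.mk (BE b n) (continuantBasis b q) := by
  let f : SymmetricAlgebra k U →ₗ[k] SymmetricAlgebra k U ⧸ BE b n :=
    ∑ q ∈ standardExponents n, ((-1 : k) ^ q.2.2 • (pairing (phi b n) ∘ₗ
      LinearMap.mulRight k (continuantBasis b (dualExponent n q)))).smulRight
        (Ideal.Quotient.mk (BE b n) (continuantBasis b q))
  suffices h : (Ideal.Quotient.mkₐ k (BE b n)).toLinearMap = f by
    have := congr($h r)
    simpa [f] using this
  refine LinearMap.ext_on_range (span_continuantBasis b) fun p => ?_
  trans Ideal.Quotient.mk (BE b n) (continuantBasis b p)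
  · rfl
  trans ∑ q ∈ standardExponents n, if p = q then
    Ideal.Quotient.mk (BE b n) (continuantBasis b q) else 0
  · rw [Finset.sum_ite_eq]
    split_ifs with hp
    · rfl
    · rw [mem_standardExponents, not_lt] at hp
      exact Ideal.Quotient.eq_zero_iff_mem.2 (continuantBasis_mem_BE b hp)
  · rw [LinearMap.sum_apply]
    refine Finset.sum_congr rfl fun q hq => ?_
    simp only [LinearMap.smulRight_apply, LinearMap.smul_apply, LinearMap.comp_apply,
      LinearMap.mulRight_apply, pairing_phi_mul_dualExponent b p hq]
    split_ifs
    · rw [smul_eq_mul, ← mul_pow]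
      simp
    · simp

/-- The coefficients in `mk_eq_sum` are pairings with `r φ_n`, so they vanish when `r` kills `φ_n`.
-/
theorem mem_BE_iff {n : ℕ} {r : SymmetricAlgebra k U} : r ∈ BE b n ↔ r • phi b n = 0 := by
  refine ⟨smul_phi_eq_zero_of_mem b, fun h => ?_⟩
  rw [← Ideal.Quotient.eq_zero_iff_mem, mk_eq_sum]
  refine Finset.sum_eq_zero fun q _ => ?_
  rw [mul_comm r, ← pairing_smul_left, h, pairing_apply, smul_zero, map_zero, mul_zero, zero_smul]

theorem finite_quotient_BE (n : ℕ) : Module.Finite k (SymmetricAlgebra k U ⧸ BE b n) := by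
  classical
  refine ⟨⟨(standardExponents n).image fun q =>
    Ideal.Quotient.mk (BE b n) (continuantBasis b q), eq_top_iff.2 fun a _ => ?_⟩⟩
  obtain ⟨r, rfl⟩ := Ideal.Quotient.mk_surjective a
  rw [mk_eq_sum]
  exact Submodule.sum_mem _ fun q hq => Submodule.smul_mem _ _
    (Submodule.subset_span (Finset.mem_coe.2 (Finset.mem_image_of_mem _ hq)))

theorem inverseSystem_BE (n : ℕ) :
    inverseSystem (BE b n) = Submodule.span (SymmetricAlgebra k U) {phi b n} := by
  apply le_antisymm
  · intro w hw
    rw [inverseSystem, Submodule.mem_torsionBySet_iff] at hw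
    rw [Submodule.mem_span_singleton]
    -- The multiplier is the expansion in the dual elements that reproduces the pairings of `w` with
    -- the standard elements. On non-standard elements both sides pair to zero, since these lie in
    -- `BE_n`.
    refine ⟨∑ q ∈ standardExponents n, ((-1) ^ q.2.2 * pairing w (continuantBasis b q)) •
      continuantBasis b (dualExponent n q), ?_⟩
    rw [eq_comm, ← sub_eq_zero]
    refine eq_zero_of_pairing_eq_zero b fun r => ?_
    rw [pairing_sub, sub_eq_zero]
    suffices h : pairing w = pairing ((∑ q ∈ standardExponents n,
        ((-1) ^ q.2.2 * pairing w (continuantBasis b q)) •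
          continuantBasis b (dualExponent n q)) • phi b n) from congr($h r)
    refine LinearMap.ext_on_range (span_continuantBasis b) fun p => ?_
    rw [pairing_smul_left, Finset.mul_sum, map_sum]
    trans ∑ q ∈ standardExponents n, if p = q then pairing w (continuantBasis b q) else 0
    · rw [Finset.sum_ite_eq]
      split_ifs with hp
      · rfl
      · rw [mem_standardExponents, not_lt] at hp
        rw [pairing_apply, hw ⟨_, continuantBasis_mem_BE b hp⟩, map_zero]
    · refine Finset.sum_congr rfl fun q hq => ?_
      rw [mul_smul_comm, map_smul, pairing_phi_mul_dualExponent b p hq]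
      split_ifs
      · rw [smul_eq_mul, mul_right_comm, ← mul_pow]
        simp
      · simp
  · rw [Submodule.span_le, Set.singleton_subset_iff]
    rw [SetLike.mem_coe, inverseSystem, Submodule.mem_torsionBySet_iff]
    exact fun r => smul_phi_eq_zero_of_mem b r.2

/-! ### Socle and homogeneity -/

theorem finrank_socle_BE {n : ℕ} (hn : 0 < n) : Module.finrank k (socle (BE b n)) = 1 := by
  -- The generator is `x^(n-1) y^(n-1)`: each variable moves it to a non-standard exponent, and it
  -- sends `φ_n` to `1`.
  set s₀ := continuantBasis b (n - 1, n - 1, 0) with hs₀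
  have hι : ∀ u, SymmetricAlgebra.ι k U u * s₀ ∈ BE b n := by
    refine ι_mul_mem b ((BE b n).restrictScalars k) fun j => ?_
    rw [Submodule.restrictScalars_mem]
    fin_cases j
    · refine (ι_zero_mul_continuantBasis b (n - 1) (n - 1) 0).symm ▸ continuantBasis_mem_BE b ?_
      simp; omega
    · refine (ι_one_mul_continuantBasis b (n - 1) (n - 1) 0).symm ▸ continuantBasis_mem_BE b ?_
      simp; omega
    · refine (ι_two_mul_continuantBasis_zero b (n - 1) (n - 1)).symm ▸
        continuantBasis_mem_BE b ?_
      simp; omega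
  have hε : augmentation k U (s₀ • phi b n) = 1 := by
    rw [← pairing_apply, ← mul_one s₀, ← continuantBasis_zero b, pairing_phi_continuantBasis_mul,
      if_pos (by simp; omega)]
    simp
  have hconst : ∀ s, (∀ u, SymmetricAlgebra.ι k U u * s ∈ BE b n) →
      s • phi b n = algebraMap k _ (augmentation k U (s • phi b n)) := by
    intro s hs
    refine eq_algebraMap_of_contract_eq_zero b fun u => ?_
    rw [← mul_smul]
    exact smul_phi_eq_zero_of_mem b (hs u)
  have hmem : Ideal.Quotient.mk (BE b n) s₀ ∈ socle (BE b n) := fun u => by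
    rw [← map_mul]
    exact Ideal.Quotient.eq_zero_iff_mem.2 (hι u)
  refine finrank_eq_one (⟨_, hmem⟩ : socle (BE b n)) ?_ ?_
  · intro h
    have h' : s₀ • phi b n = 0 :=
      smul_phi_eq_zero_of_mem b (Ideal.Quotient.eq_zero_iff_mem.1 congr(Subtype.val $h))
    rw [h', map_zero] at hε
    exact zero_ne_one hε
  · rintro ⟨a, ha⟩
    obtain ⟨s, rfl⟩ := Ideal.Quotient.mk_surjective a
    have hs : ∀ u, SymmetricAlgebra.ι k U u * s ∈ BE b n := fun u => by
      rw [← Ideal.Quotient.eq_zero_iff_mem, map_mul]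
      exact ha u
    refine ⟨augmentation k U (s • phi b n), Subtype.ext ?_⟩
    change augmentation k U (s • phi b n) • Ideal.Quotient.mkₐ k (BE b n) s₀ =
      Ideal.Quotient.mkₐ k (BE b n) s
    rw [← map_smul]
    -- Both `s` and the multiple of `s₀` send `φ_n` to the same constant, so their difference kills
    -- `φ_n`.
    refine Ideal.Quotient.eq.2 ((mem_BE_iff b).2 ?_)
    rw [sub_smul, smul_smul_of_field, hconst s₀ hι, hε, map_one, hconst s hs,
      Algebra.algebraMap_eq_smul_one, sub_eq_zero]
    simp

theorem symContinuant_mem_symDegree (i : ℕ) : symContinuant b i ∈ symDegree k U i := by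
  have hι : ∀ u, SymmetricAlgebra.ι k U u ∈ symDegree k U 1 := fun u => by
    rw [symDegree, pow_one]
    exact ⟨u, rfl⟩
  have hmul : ∀ {r s c d}, r ∈ symDegree k U c → s ∈ symDegree k U d →
      r * s ∈ symDegree k U (c + d) := fun hr hs => by
    rw [symDegree, pow_add]
    exact Submodule.mul_mem_mul hr hs
  induction i using Nat.twoStepInduction with
  | zero =>
    rw [symContinuant_zero, symDegree, pow_zero]
    exact Submodule.one_le.1 le_rfl
  | one => exact hι _
  | more i h1 h2 =>
    refine Submodule.add_mem _ ?_ ?_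
    · rw [show i + 2 = 1 + (i + 1) by ring]
      exact hmul (hι _) h2
    · rw [show i + 2 = 1 + 1 + i by ring]
      exact hmul (hmul (hι _) (hι _)) h1

theorem isHomogeneousIdeal_BE (n : ℕ) : IsHomogeneousIdeal (BE b n) := by
  refine le_antisymm (Ideal.span_le.2 fun r hr => hr.1) ?_
  have h : ∀ j m i, SymmetricAlgebra.ι k U (b j) ^ m * symContinuant b i ∈
      symDegree k U (m + i) := fun j m i => by
    rw [symDegree, pow_add]
    exact Submodule.mul_mem_mul (Submodule.pow_mem_pow _ (LinearMap.mem_range_self _ _) m)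
      (symContinuant_mem_symDegree b i)
  conv_lhs => rw [BE_eq_span]
  refine Ideal.span_le.2 fun r hr => Ideal.subset_span ⟨?_, ?_⟩
  · rw [BE_eq_span]
    exact Ideal.subset_span hr
  · obtain ⟨m, i, _, rfl | rfl⟩ := hr
    · exact ⟨_, h 0 m i⟩
    · exact ⟨_, h 1 m i⟩

theorem phi_mem_dpDegree (n : ℕ) : phi b n ∈ dpDegree k U (2 * n - 2) := by
  refine Submodule.sum_mem _ fun i hi => Submodule.smul_mem _ _ (Submodule.subset_span ?_)
  rw [Finset.mem_range] at hi
  refine ⟨[(n - 1 - i, b.coord 0), (n - 1 - i, b.coord 1), (2 * i, b.coord 2)], ?_, ?_⟩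
  · simp only [List.map_cons, List.map_nil, List.sum_cons, List.sum_nil]
    omega
  · simp [mul_assoc]

theorem isGorensteinIdeal_BE {n : ℕ} (hn : 0 < n) : IsGorensteinIdeal (BE b n) where
  homogeneous := isHomogeneousIdeal_BE b n
  artinian :=
    have := finite_quotient_BE b n
    IsArtinianRing.of_finite k _
  finrank_socle := finrank_socle_BE b hn

end MainResult

end MacaulayInverse

end

theorem mainTheorem10 {k : Type*} [Field k] {U : Type*} [AddCommGroup U] [Module k U]
    (b : Module.Basis (Fin 3) k U) (n : ℕ) (hn : 0 < n) :
    MacaulayInverse.IsGorensteinIdeal (MacaulayInverse.BE b n) ∧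
    MacaulayInverse.phi b n ∈ MacaulayInverse.dpDegree k U (2 * n - 2) ∧
    MacaulayInverse.inverseSystem (MacaulayInverse.BE b n) =
      Submodule.span (SymmetricAlgebra k U) {MacaulayInverse.phi b n} :=
  ⟨MacaulayInverse.isGorensteinIdeal_BE b hn, MacaulayInverse.phi_mem_dpDegree b n,
    MacaulayInverse.inverseSystem_BE b n⟩
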